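/- Let $n\ge 1$ and let $\mathcal F$ be a family of subsets of an $n$-element set such that for every two distinct members $F,F'\in\mathcal F$ the cardinality of the symmetric difference $(F\setminus F')\cup(F'\setminus F)$ is not divisible by $4$. Then $|\mathcal F|\le 2n$ if $n\equiv 0,1,2 \pmod 4$, and $|\mathcal F|\le 2n+2$ if $n\equiv 3\pmod 4$. This bound is sharp: for every $n\ge 1$ and every $n$-element set there is such a family for which equality holds. -/

import Mathlib

/-- The Hamming distance of two finite sets: the cardinality of their symmetric difference. -/
def setDist {α : Type*} [DecidableEq α] (A B : Finset α) : ℕ :=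
  ((A \ B) ∪ (B \ A)).card

/-- A family of sets such that the distance of any two distinct members is not a multiple
of `4`. -/
def AvoidsFour {α : Type*} [DecidableEq α] (F : Finset (Finset α)) : Prop :=
  ∀ A ∈ F, ∀ B ∈ F, A ≠ B → ¬ 4 ∣ setDist A B

/-- The bound: `2n + 2` if `n ≡ 3 (mod 4)`, and `2n` if `n ≡ 0, 1, 2 (mod 4)`. -/
def familyBound (n : ℕ) : ℕ :=
  if n % 4 = 3 then 2 * n + 2 else 2 * n

open Finset

section Distance

variable {α : Type*} [DecidableEq α]

/-! Split the family by parity of size: within a class distances are even, hence 2 mod 4.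
Translating a class `G` by one of its members leaves |G| - 1 sets of size 2 mod 4 with odd pairwise
intersections. By `eq_of_even_cover`, their indicators over the two-element field are independent
unless |G| ≡ 0 mod 4. They lie in the hyperplane of even-weight vectors, so |G| ≤ n. In the
exceptional case, deleting one member gives |G| ≤ n + 1, with equality only if n ≡ 3 mod 4. -/

theorem setDist_eq_card_symmDiff (A B : Finset α) : setDist A B = (symmDiff A B).card := rfl

theorem card_symmDiff_add_two_mul_card_inter (A B : Finset α) :
    (symmDiff A B).card + 2 * (A ∩ B).card = A.card + B.card := by
  have h1 : (symmDiff A B).card = (A \ B).card + (B \ A).card :=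
    card_union_of_disjoint disjoint_sdiff_sdiff
  have h2 := card_sdiff_add_card_inter A B
  have h3 := card_sdiff_add_card_inter B A
  rw [inter_comm B A] at h3
  omega

theorem setDist_symmDiff_left (C A B : Finset α) :
    setDist (symmDiff C A) (symmDiff C B) = setDist A B := by
  simp only [setDist_eq_card_symmDiff]
  rw [symmDiff_symmDiff_symmDiff_comm, symmDiff_self, bot_symmDiff]

theorem setDist_comm (A B : Finset α) : setDist A B = setDist B A := by
  simp only [setDist_eq_card_symmDiff, symmDiff_comm]

theorem setDist_mod_two (A B : Finset α) : setDist A B % 2 = (A.card + B.card) % 2 := by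
  have := card_symmDiff_add_two_mul_card_inter A B
  rw [setDist_eq_card_symmDiff]
  omega

/-- Any two distinct members of the family have distance `2` modulo `4`. -/
def PairwiseDistTwo (G : Finset (Finset α)) : Prop :=
  ∀ A ∈ G, ∀ B ∈ G, A ≠ B → setDist A B % 4 = 2

/-- All members have size `2` modulo `4` and distinct members meet in an odd number of points. -/
def OddIntersecting (H : Finset (Finset α)) : Prop :=
  (∀ A ∈ H, A.card % 4 = 2) ∧ ∀ A ∈ H, ∀ B ∈ H, A ≠ B → (A ∩ B).card % 2 = 1

theorem OddIntersecting.mono {H T : Finset (Finset α)} (hH : OddIntersecting H) (hT : T ⊆ H) :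
    OddIntersecting T :=
  ⟨fun A hA => hH.1 A (hT hA), fun A hA B hB => hH.2 A (hT hA) B (hT hB)⟩

theorem sum_card_filter_mem_of_mem (T : Finset (Finset α)) (A : Finset α) :
    ∑ x ∈ A, (T.filter (x ∈ ·)).card = ∑ B ∈ T, (A ∩ B).card := by
  simp only [card_filter]
  rw [sum_comm]
  refine sum_congr rfl fun B _ => ?_
  rw [← card_filter, filter_mem_eq_inter]

theorem PairwiseDistTwo.oddIntersecting_shift {G : Finset (Finset α)} (hG : PairwiseDistTwo G)
    {C : Finset α} (hC : C ∈ G) : OddIntersecting ((G.erase C).image (symmDiff C)) := by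
  have hsize : ∀ A ∈ G.erase C, (symmDiff C A).card % 4 = 2 := fun A hA =>
    hG C hC A (mem_of_mem_erase hA) (ne_of_mem_erase hA).symm
  constructor
  · exact forall_mem_image.2 hsize
  · intro A hA B hB hAB
    obtain ⟨A, hA', rfl⟩ := mem_image.1 hA
    obtain ⟨B, hB', rfl⟩ := mem_image.1 hB
    have h1 := hG A (mem_of_mem_erase hA') B (mem_of_mem_erase hB') (by rintro rfl; exact hAB rfl)
    rw [← setDist_symmDiff_left C, setDist_eq_card_symmDiff] at h1
    have h2 := card_symmDiff_add_two_mul_card_inter (symmDiff C A) (symmDiff C B)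
    have h3 := hsize A hA'
    have h4 := hsize B hB'
    omega

/-- Toggling a fixed point in every member gives an isometric copy of opposite parity; distances
between the two copies are odd. -/
theorem PairwiseDistTwo.exists_avoidsFour [Nonempty α] {G : Finset (Finset α)}
    (hG : PairwiseDistTwo G) (hodd : ∀ A ∈ G, A.card % 2 = 1) :
    ∃ F : Finset (Finset α), AvoidsFour F ∧ F.card = 2 * G.card := by
  obtain ⟨x⟩ := ‹Nonempty α›
  have heven : ∀ A ∈ G.image (symmDiff {x}), A.card % 2 = 0 := by
    intro A hA
    obtain ⟨B, hB, rfl⟩ := mem_image.1 hA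
    have h1 := card_symmDiff_add_two_mul_card_inter {x} B
    have h2 := hodd B hB
    rw [card_singleton] at h1
    omega
  have hshift : PairwiseDistTwo (G.image (symmDiff {x})) := by
    intro A hA B hB hAB
    obtain ⟨A, hA', rfl⟩ := mem_image.1 hA
    obtain ⟨B, hB', rfl⟩ := mem_image.1 hB
    rw [setDist_symmDiff_left]
    exact hG A hA' B hB' (by rintro rfl; exact hAB rfl)
  refine ⟨G ∪ G.image (symmDiff {x}), ?_, ?_⟩
  · intro A hA B hB hAB
    have hpar := setDist_mod_two A B
    rcases mem_union.1 hA with hA | hA <;> rcases mem_union.1 hB with hB | hB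
    · have := hG A hA B hB hAB
      omega
    · have := hodd A hA
      have := heven B hB
      omega
    · have := heven A hA
      have := hodd B hB
      omega
    · have := hshift A hA B hB hAB
      omega
  · have himage : (G.image (symmDiff {x})).card = G.card :=
      card_image_of_injective _ (symmDiff_right_injective {x})
    rw [card_union_of_disjoint, himage, two_mul]
    refine disjoint_left.2 fun A hA hA' => ?_
    have := hodd A hA
    have := heven A hA'
    omega

/-! ### Upper bound -/

variable [Fintype α]

/-- The sum of squares counts |A ∩ B| over ordered pairs: the diagonal gives 2|T| mod 4, and each
unordered pair gives twice an odd number. -/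
theorem OddIntersecting.sum_sq_mod_four {T : Finset (Finset α)} (hT : OddIntersecting T) :
    (∑ x, (T.filter (x ∈ ·)).card ^ 2) % 4 = (T.card * (T.card + 1)) % 4 := by
  induction T using Finset.induction_on with
  | empty => simp
  | insert A T hA ih =>
    have ih' := ih (hT.mono (subset_insert A T))
    have hc : ∀ x, ((insert A T).filter (x ∈ ·)).card ^ 2 = (T.filter (x ∈ ·)).card ^ 2 +
        if x ∈ A then 2 * (T.filter (x ∈ ·)).card + 1 else 0 := by
      intro x
      rw [filter_insert]
      split_ifs with h
      · rw [card_insert_of_notMem (by simp [hA])]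
        ring
      · simp
    have hpar : (∑ B ∈ T, (A ∩ B).card) % 2 = T.card % 2 := by
      rw [sum_nat_mod, sum_congr rfl (g := fun _ => 1)]
      · simp
      · intro B hB
        exact hT.2 A (mem_insert_self A T) B (mem_insert_of_mem hB)
          (by rintro rfl; exact hA hB)
    have hcard := hT.1 A (mem_insert_self A T)
    rw [sum_congr rfl fun x _ => hc x, sum_add_distrib, sum_ite_mem, univ_inter, sum_add_distrib,
      ← mul_sum, sum_card_filter_mem_of_mem, card_insert_of_notMem hA]
    simp only [sum_const, smul_eq_mul, mul_one]
    have hring : (T.card + 1) * (T.card + 1 + 1) = T.card * (T.card + 1) + 2 * T.card + 2 := by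
      ring
    rw [hring]
    omega

/-- A nonempty odd-intersecting subfamily covering every point an even number of times is the
whole family, and its size is `3` modulo `4`. -/
theorem OddIntersecting.eq_of_even_cover {H T : Finset (Finset α)} (hH : OddIntersecting H)
    (hTH : T ⊆ H) (hT : T.Nonempty) (heven : ∀ x, (T.filter (x ∈ ·)).card % 2 = 0) :
    T = H ∧ T.card % 4 = 3 := by
  have hsum : ∀ A : Finset α, (∑ B ∈ T, (A ∩ B).card) % 2 = 0 := by
    intro A
    rw [← sum_card_filter_mem_of_mem, sum_nat_mod]
    simp [heven]
  have hodd : ∀ A ∈ H, ∀ S ⊆ T, A ∉ S → (∑ B ∈ S, (A ∩ B).card) % 2 = S.card % 2 := by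
    intro A hA S hS hAS
    rw [sum_nat_mod, sum_congr rfl (g := fun _ => 1)]
    · simp
    · intro B hB
      exact hH.2 A hA B (hTH (hS hB)) (by rintro rfl; exact hAS hB)
  have hTodd : T.card % 2 = 1 := by
    obtain ⟨A, hA⟩ := hT
    -- The term |A ∩ A| is even, so the other |T| - 1 odd terms must sum to an even number.
    have h1 := hodd A (hTH hA) (T.erase A) (erase_subset A T) (notMem_erase A T)
    have h2 := hsum A
    rw [← add_sum_erase T _ hA, inter_self] at h2
    have h3 := hH.1 A (hTH hA)
    have h4 := card_erase_add_one hA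
    omega
  refine ⟨hTH.antisymm fun A hA => ?_, ?_⟩
  · by_contra hAT
    -- A member outside `T` would force |T| to be even.
    have h1 := hodd A hA T subset_rfl hAT
    have h2 := hsum A
    omega
  · have hsq := (hH.mono hTH).sum_sq_mod_four
    have hzero : (∑ x, (T.filter (x ∈ ·)).card ^ 2) % 4 = 0 := by
      refine Nat.mod_eq_zero_of_dvd (dvd_sum fun x _ => ?_)
      exact pow_dvd_pow_of_dvd (Nat.dvd_of_mod_eq_zero (heven x)) 2
    rw [hzero] at hsq
    have : T.card % 4 = 1 ∨ T.card % 4 = 3 := by omega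
    rcases this with h | h
    · rw [Nat.mul_mod, Nat.add_mod, h] at hsq
      norm_num at hsq
    · exact h

/-- The indicator vector over the field with two elements. -/
def indicatorTwo (A : Finset α) : α → ZMod 2 := fun x => if x ∈ A then 1 else 0

theorem OddIntersecting.linearIndepOn {H : Finset (Finset α)} (hH : OddIntersecting H)
    (hcard : H.card % 4 ≠ 3) : LinearIndepOn (ZMod 2) indicatorTwo (H : Set (Finset α)) := by
  rw [linearIndepOn_finset_iff]
  intro f hf A hA
  by_contra hfA
  have hone : ∀ a : ZMod 2, a ≠ 0 → a = 1 := by decide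
  obtain ⟨hTH, hT3⟩ := hH.eq_of_even_cover (T := H.filter (f · ≠ 0)) (filter_subset _ _)
    ⟨A, mem_filter.2 ⟨hA, hfA⟩⟩ (by
      intro x
      have hx := congrFun hf x
      rw [Finset.sum_apply] at hx
      simp only [Pi.smul_apply, indicatorTwo, smul_eq_mul, Pi.zero_apply] at hx
      refine Nat.mod_eq_zero_of_dvd ((ZMod.natCast_eq_zero_iff _ 2).1 ?_)
      refine Eq.trans ?_ hx
      rw [card_filter, sum_filter, Nat.cast_sum]
      refine sum_congr rfl fun B _ => ?_
      by_cases hB : f B = 0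
      · simp [hB]
      · rw [hone _ hB]
        simp)
  rw [hTH] at hT3
  exact hcard hT3

theorem OddIntersecting.card_lt [Nonempty α] {H : Finset (Finset α)} (hH : OddIntersecting H)
    (hcard : H.card % 4 ≠ 3) : H.card < Fintype.card α := by
  let φ : (α → ZMod 2) →ₗ[ZMod 2] ZMod 2 := ∑ x, LinearMap.proj x
  have hφ : ∀ v, φ v = ∑ x, v x := fun v => by simp [φ]
  have hlt : Module.finrank (ZMod 2) (LinearMap.ker φ) < Fintype.card α := by
    rw [← Module.finrank_fintype_fun_eq_card (ZMod 2) (η := α)]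
    refine Submodule.finrank_lt fun htop => ?_
    obtain ⟨x⟩ := ‹Nonempty α›
    have hx : Pi.single x (1 : ZMod 2) ∈ LinearMap.ker φ := htop ▸ Submodule.mem_top
    rw [LinearMap.mem_ker, hφ, sum_pi_single'] at hx
    simp at hx
  refine lt_of_le_of_lt ?_ hlt
  have hspan := finrank_span_eq_card (hH.linearIndepOn hcard)
  rw [← Fintype.card_coe H]
  refine hspan.symm.le.trans (Submodule.finrank_mono (Submodule.span_le.2 ?_))
  rintro _ ⟨⟨A, hA⟩, rfl⟩
  have hA2 := hH.1 A hA
  simp only [SetLike.mem_coe, LinearMap.mem_ker, hφ, indicatorTwo, sum_boole]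
  rw [ZMod.natCast_eq_zero_iff, filter_mem_eq_inter, univ_inter]
  omega

theorem PairwiseDistTwo.card_le_of_mod_ne [Nonempty α] {G : Finset (Finset α)}
    (hG : PairwiseDistTwo G) (hcard : G.card % 4 ≠ 0) : G.card ≤ Fintype.card α := by
  obtain ⟨C, hC⟩ : G.Nonempty := card_pos.1 (by omega)
  have himage : ((G.erase C).image (symmDiff C)).card = (G.erase C).card :=
    card_image_of_injective _ (symmDiff_right_injective C)
  have herase := card_erase_add_one hC
  have := (hG.oddIntersecting_shift hC).card_lt (by omega)
  omega

theorem PairwiseDistTwo.two_mul_card_le [Nonempty α] {G : Finset (Finset α)}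
    (hG : PairwiseDistTwo G) : 2 * G.card ≤ familyBound (Fintype.card α) := by
  have hmain : G.card ≤ Fintype.card α ∨
      Fintype.card α % 4 = 3 ∧ G.card ≤ Fintype.card α + 1 := by
    by_cases h : G.card % 4 = 0
    · rcases G.eq_empty_or_nonempty with rfl | ⟨C, hC⟩
      · simp
      -- Now |G| - 1 ≡ 3 mod 4, so the previous bound applies to `G` without `C`.
      · have herase := card_erase_add_one hC
        have hsub : PairwiseDistTwo (G.erase C) := fun A hA B hB =>
          hG A (mem_of_mem_erase hA) B (mem_of_mem_erase hB)
        have := hsub.card_le_of_mod_ne (by omega)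
        omega
    · exact Or.inl (hG.card_le_of_mod_ne h)
  unfold familyBound
  split_ifs <;> omega

theorem AvoidsFour.card_le [Nonempty α] {F : Finset (Finset α)} (hF : AvoidsFour F) :
    F.card ≤ familyBound (Fintype.card α) := by
  have hclass : ∀ p : Finset α → Prop, [DecidablePred p] →
      (∀ A B, p A → p B → A.card % 2 = B.card % 2) → PairwiseDistTwo (F.filter p) := by
    intro p _ hp A hA B hB hAB
    rw [mem_filter] at hA hB
    have h1 := hF A hA.1 B hB.1 hAB
    have h2 := setDist_mod_two A B
    have h3 := hp A B hA.2 hB.2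
    omega
  have h0 := (hclass (fun A => A.card % 2 = 0) (by intros; omega)).two_mul_card_le
  have h1 := (hclass (fun A => ¬ A.card % 2 = 0) (by intros; omega)).two_mul_card_le
  have := card_filter_add_card_filter_not (s := F) (fun A => A.card % 2 = 0)
  omega

/-! ### Extremal families -/

theorem pairwiseDistTwo_singletons :
    PairwiseDistTwo (univ.image (singleton : α → Finset α)) := by
  intro A hA B hB hAB
  obtain ⟨a, -, rfl⟩ := mem_image.1 hA
  obtain ⟨b, -, rfl⟩ := mem_image.1 hB
  have h := card_symmDiff_add_two_mul_card_inter {a} {b}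
  rw [singleton_inter_of_notMem (by simpa using hAB)] at h
  rw [setDist_eq_card_symmDiff]
  simp only [card_singleton, card_empty] at h
  omega

theorem pairwiseDistTwo_insert_univ (hα : Fintype.card α % 4 = 3) :
    PairwiseDistTwo (insert univ (univ.image (singleton : α → Finset α))) := by
  have huniv : ∀ a : α, setDist univ {a} % 4 = 2 := by
    intro a
    have h := card_symmDiff_add_two_mul_card_inter univ {a}
    rw [univ_inter, card_singleton, card_univ] at h
    rw [setDist_eq_card_symmDiff]
    omega
  intro A hA B hB hAB
  rcases mem_insert.1 hA with rfl | hA' <;> rcases mem_insert.1 hB with rfl | hB'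
  · exact absurd rfl hAB
  · obtain ⟨b, -, rfl⟩ := mem_image.1 hB'
    exact huniv b
  · obtain ⟨a, -, rfl⟩ := mem_image.1 hA'
    rw [setDist_comm]
    exact huniv a
  · exact pairwiseDistTwo_singletons A hA' B hB' hAB

theorem exists_avoidsFour_card_eq [Nonempty α] :
    ∃ F : Finset (Finset α), AvoidsFour F ∧ F.card = familyBound (Fintype.card α) := by
  have hsing : (univ.image (singleton : α → Finset α)).card = Fintype.card α :=
    card_image_of_injective _ singleton_injective
  have hodd : ∀ A ∈ univ.image (singleton : α → Finset α), A.card % 2 = 1 := by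
    simp
  unfold familyBound
  split_ifs with h
  · have hnot : (univ : Finset α) ∉ univ.image (singleton : α → Finset α) := by
      intro hmem
      obtain ⟨a, -, ha⟩ := mem_image.1 hmem
      have := congrArg card ha
      rw [card_singleton, card_univ] at this
      omega
    obtain ⟨F, hF, hcard⟩ := (pairwiseDistTwo_insert_univ h).exists_avoidsFour (by
      intro A hA
      rcases mem_insert.1 hA with rfl | hA
      · rw [card_univ]
        omega
      · exact hodd A hA)
    refine ⟨F, hF, ?_⟩
    rw [hcard, card_insert_of_notMem hnot, hsing]
    ring
  · obtain ⟨F, hF, hcard⟩ := pairwiseDistTwo_singletons.exists_avoidsFour hodd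
    exact ⟨F, hF, by rw [hcard, hsing]⟩

end Distance

theorem theorem1 {α : Type*} [Fintype α] [DecidableEq α] (n : ℕ) (hn : 1 ≤ n)
    (hα : Fintype.card α = n) :
    (∀ F : Finset (Finset α), AvoidsFour F → F.card ≤ familyBound n) ∧
      ∃ F : Finset (Finset α), AvoidsFour F ∧ F.card = familyBound n := by
  subst hα
  have : Nonempty α := Fintype.card_pos_iff.1 hn
  exact ⟨fun F hF => hF.card_le, exists_avoidsFour_card_eq⟩
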